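/- Let $\mathcal X$ be a finite nonempty alphabet, $\mathcal H$ a complex Hilbert space, and $x\mapsto|\psi_x\rangle\in\mathcal H$ ($x\in\mathcal X$) a pure-state classical-quantum channel, i.e. every $|\psi_x\rangle$ is a unit vector. Let $N\ge 1$. An inner code of blocklength $N$ with $M$ messages assigns to each $j\in\{1,\dots,M\}$ a word $(x_1(j),\dots,x_N(j))\in\mathcal X^N$, and hence the product state $|\Psi_j\rangle=|\psi_{x_1(j)}\rangle\otimes\cdots\otimes|\psi_{x_N(j)}\rangle\in\mathcal H^{\otimes N}$. A joint measurement is a POVM $(E_k)_{k=1}^M$ on $\mathcal H^{\otimes N}$ (positive operators with $\sum_k E_k=1$), and the induced superchannel has transition probabilities $p^{(N)}_{k|j}=\langle\Psi_j|E_k|\Psi_j\rangle$, $j,k\in\{1,\dots,M\}$. Define $$C_N=\sup\, I(p_j,p^{(N)}_{k|j}),\qquad I(p_j,p_{k|j})=\sum_{j,k}p_j\,p_{k|j}\log\frac{p_{k|j}}{\sum_i p_i\,p_{k|i}},$$ where the supremum is over all $M\ge1$, all inner codes of blocklength $N$ with $M$ messages, all joint measurements with $M$ outcomes, and all probability distributions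 $(p_j)$ on $\{1,\dots,M\}$. ($C_N/N$ is the best rate, in nats per channel use, of concatenated codes whose joint measurements act on length-$N$ blocks.) For a probability distribution $P_X$ on $\mathcal X$ put $\rho=\sum_{x}P_X(x)|\psi_x\rangle\langle\psi_x|$, and for $R\ge 0$ put $$E(R)=\max_{0\le s\le 1}\Big[\max_{P_X}\big(-\log\operatorname{Tr}\rho^{1+s}\big)-sR\Big].$$ Then $C_N<\infty$, the maxima in the definition of $E(R)$ and the maximum below are attained, and $$\frac{C_N}{N}\;\ge\;\max_{R\ge 0}\Big[\big(1-2e^{-N E(R)}\big)R-\frac{\log 2}{N}\Big].$$ -/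

import Mathlib

open scoped TensorProduct

noncomputable section

namespace CQ

universe u v

/-! ### The `N`-fold Hilbert-space tensor power -/

/-- A bundled complex Hilbert space (only used to define tensor powers by recursion). -/
structure HilbertSpace : Type (u + 1) where
  carrier : Type u
  [normed : NormedAddCommGroup carrier]
  [inner : InnerProductSpace ℂ carrier]
  [complete : CompleteSpace carrier]

attribute [instance] HilbertSpace.normed HilbertSpace.inner HilbertSpace.complete

/-- `H^{⊗N}`: the one-dimensional space `ℂ` for `N = 0`, and the Hilbert-space tensor product
(the completion of the algebraic one) `H ⊗ H^{⊗n}` for `N = n + 1`. -/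
def tensorPower (H : Type u) [NormedAddCommGroup H] [InnerProductSpace ℂ H] : ℕ → HilbertSpace.{u}
  | 0 => { carrier := EuclideanSpace ℂ PUnit.{u + 1} }
  | n + 1 => { carrier := UniformSpace.Completion (H ⊗[ℂ] (tensorPower H n).carrier) }

/-- The underlying type of `H^{⊗N}`. -/
abbrev TPow (H : Type u) [NormedAddCommGroup H] [InnerProductSpace ℂ H] (N : ℕ) : Type u :=
  (tensorPower H N).carrier

/-- The product vector `v₀ ⊗ v₁ ⊗ ⋯ ⊗ v_{N-1}` in `H^{⊗N}`. -/
def productVector {H : Type u} [NormedAddCommGroup H] [InnerProductSpace ℂ H] :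
    (N : ℕ) → (Fin N → H) → TPow H N
  | 0, _ => (EuclideanSpace.single PUnit.unit (1 : ℂ) : EuclideanSpace ℂ PUnit.{u + 1})
  | n + 1, v =>
      ((v 0 ⊗ₜ[ℂ] productVector n (fun i => v i.succ) : H ⊗[ℂ] TPow H n) :
        UniformSpace.Completion (H ⊗[ℂ] TPow H n))

/-! ### Measurements, inner codes and the superchannel -/

/-- A quantum measurement (positive operator valued measure) with outcomes `0, …, M - 1`. -/
structure POVM (K : Type u) [NormedAddCommGroup K] [InnerProductSpace ℂ K] (M : ℕ) where
  effect : Fin M → K →L[ℂ] K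
  isPositive : ∀ k, (effect k).IsPositive
  sum_effect : ∑ k, effect k = 1

/-- The transition probability `p(k | j)` of the superchannel: message `j` is encoded as the
codeword `c j`, the received state is the product state of the letters of `c j`, and the joint
measurement `E` on `H^{⊗N}` returns `k`. -/
def superchannel {X : Type v} {H : Type u} [NormedAddCommGroup H] [InnerProductSpace ℂ H]
    (ψ : X → H) {N M : ℕ} (c : Fin M → Fin N → X) (E : POVM (TPow H N) M) (j k : Fin M) : ℝ :=
  (inner ℂ (productVector N fun i => ψ (c j i))
    (E.effect k (productVector N fun i => ψ (c j i)))).re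

/-- Mutual information (in nats) of the input distribution `p` and the transition probabilities
`W j k = W(k | j)`. Terms with `p j * W j k = 0` vanish. -/
def mutualInfo {M : ℕ} (p : Fin M → ℝ) (W : Fin M → Fin M → ℝ) : ℝ :=
  ∑ j, ∑ k, p j * W j k * Real.log (W j k / ∑ i, p i * W i k)

/-- All values `I(p_j, p(k | j))` over the number `M` of inner messages, the inner codes of
blocklength `N`, the joint measurements of length `N` and the input distributions `p`. -/
def superchannelInfos {X : Type v} {H : Type u} [NormedAddCommGroup H] [InnerProductSpace ℂ H]
    (ψ : X → H) (N : ℕ) : Set ℝ :=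
  {I | ∃ (M : ℕ) (c : Fin M → Fin N → X) (E : POVM (TPow H N) M),
    ∃ p ∈ stdSimplex ℝ (Fin M), I = mutualInfo p (superchannel ψ c E)}

/-- `C_N`. -/
def blockCapacity {X : Type v} {H : Type u} [NormedAddCommGroup H] [InnerProductSpace ℂ H]
    (ψ : X → H) (N : ℕ) : ℝ :=
  sSup (superchannelInfos ψ N)

/-! ### The error exponent -/

section exponent

variable {X : Type v} [Fintype X] {H : Type u} [NormedAddCommGroup H] [InnerProductSpace ℂ H]

/-- The average density operator `ρ = ∑ₓ P(x) |ψₓ⟩⟨ψₓ|`. -/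
def avgState (ψ : X → H) (P : X → ℝ) : H →L[ℂ] H :=
  ∑ x, (P x : ℂ) • InnerProductSpace.rankOne ℂ (ψ x) (ψ x)

variable [CompleteSpace H]

/-- The trace `∑ᵢ ⟨bᵢ, A bᵢ⟩` of an operator, in an orthonormal (Hilbert) basis `b`. -/
def opTrace (A : H →L[ℂ] H) : ℂ :=
  let b := (exists_hilbertBasis ℂ H).choose_spec.choose
  ∑' i, inner ℂ (b i) (A (b i))

/-- `-log Tr ρ^{1+s}`; the power is the one of the continuous functional calculus. -/
def negLogTrace (ψ : X → H) (s : ℝ) (P : X → ℝ) : ℝ :=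
  -Real.log (opTrace (avgState ψ P ^ (1 + s))).re

/-- `max_P (-log Tr ρ^{1+s})`, over the probability distributions `P` on `X`. -/
def maxNegLogTrace (ψ : X → H) (s : ℝ) : ℝ :=
  sSup (negLogTrace ψ s '' stdSimplex ℝ X)

/-- `E(R) = max_{0 ≤ s ≤ 1} (max_P (-log Tr ρ^{1+s}) - s R)`. -/
def errorExponent (ψ : X → H) (R : ℝ) : ℝ :=
  sSup ((fun s => maxNegLogTrace ψ s - s * R) '' Set.Icc 0 1)

end exponent

end CQ

end

/-!
The lower bound on `C_N` comes from random coding. Draw `m + 1` codewords independently from `P^N`.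
Let `μ a` be the eigenvalues of `ρ^{⊗N}`, whose eigenvectors are products of eigenvectors of `ρ`,
and let `B` be the projection onto the eigenvectors with `m * μ a ≤ 1`. Measure with a variant of
the pretty good measurement of the projected states `B Ψ_j` (`CQ.exists_povm_one_sub_le`). Its error
on the codeword `j` is at most `2 (1 - ‖B Ψ_j‖²) + ∑_{i ≠ j} |⟨B Ψ_i, B Ψ_j⟩|²`, because the
function of the frame operator that defines it lies above the tangent `(3 - x) / 2` of `x^{-1/2}`
at `1`.
The mean over the code is `2 ∑_{m μ a > 1} μ a + m ∑_{m μ a ≤ 1} (μ a)²`, hence at most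
`2 m^s ∑ (μ a)^{1+s} = 2 m^s (Tr ρ^{1+s})^N` for all `0 ≤ s ≤ 1` (`CQ.exists_code_mean_error_le`).
With `m + 1 = ⌈e^{NR}⌉` this is at most `2 e^{-N E(R)}`, and Fano's inequality
(`CQ.fano_le_mutualInfo`) turns the error bound into the bound on the mutual information.

The capacity is finite because, whatever the number of messages, at most `|X|^N` different codewords
are in use (`CQ.mutualInfo_le_card`).

The maxima exist by compactness. On the finite-dimensional span of the signal states, `Tr ρ^{1+s}`
is continuous in `P` by continuity of the functional calculus, and `-log Tr ρ^{1+s}` is Lipschitz in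
`s` with a constant that does not depend on `P`. This makes `max_P` continuous in `s`, and `E(R)` is
`1`-Lipschitz as a maximum of affine functions with slopes in `[-1, 0]`. It is nonpositive for large
`R`, where the rate bound therefore stays below its value at `R = 0`.
-/

/-! ### Mutual information of a stochastic matrix -/

namespace CQ

/-- Since `log t ≤ t` and `V (c j) k ≤ q k / P' (c j)`, where `q` is the output distribution and `P'`
the distribution of the codeword, the mutual information is at most `∑ j, p j / P' (c j)`, which
counts the codewords that are used: a bound that does not depend on the number of messages. -/
theorem mutualInfo_le_card {Y : Type*} [Fintype Y] {M : ℕ} {p : Fin M → ℝ}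
    (hp : p ∈ stdSimplex ℝ (Fin M)) (c : Fin M → Y) (V : Y → Fin M → ℝ)
    (hV : ∀ y k, 0 ≤ V y k) (hV1 : ∀ y, ∑ k, V y k = 1) :
    mutualInfo p (fun j k => V (c j) k) ≤ Fintype.card Y := by
  classical
  have hp0 := hp.1
  set P' : Y → ℝ := fun y => ∑ i with c i = y, p i with hP'
  have hP'0 : ∀ y, 0 ≤ P' y := fun y => Finset.sum_nonneg fun i _ => hp0 i
  have hterm : ∀ j k, p j * V (c j) k * Real.log (V (c j) k / ∑ i, p i * V (c i) k)
      ≤ p j / P' (c j) * V (c j) k := by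
    intro j k
    have hq : P' (c j) * V (c j) k ≤ ∑ i, p i * V (c i) k := by
      rw [hP', Finset.sum_mul]
      calc ∑ i with c i = c j, p i * V (c j) k = ∑ i with c i = c j, p i * V (c i) k :=
            Finset.sum_congr rfl fun i hi => by rw [(Finset.mem_filter.1 hi).2]
        _ ≤ ∑ i, p i * V (c i) k :=
            Finset.sum_le_sum_of_subset_of_nonneg (Finset.filter_subset _ _)
              fun i _ _ => mul_nonneg (hp0 i) (hV _ _)
    rcases (hp0 j).eq_or_lt with h | h
    · simp [← h]
    rcases (hV (c j) k).eq_or_lt with h' | h'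
    · simp [← h']
    have hPj : 0 < P' (c j) := h.trans_le
      (Finset.single_le_sum (f := p) (fun i _ => hp0 i) (by simp))
    have hq0 : 0 < ∑ i, p i * V (c i) k := (mul_pos hPj h').trans_le hq
    have hle : V (c j) k / ∑ i, p i * V (c i) k ≤ 1 / P' (c j) := by
      rw [div_le_div_iff₀ hq0 hPj]; linarith
    calc p j * V (c j) k * Real.log (V (c j) k / ∑ i, p i * V (c i) k)
        ≤ p j * V (c j) k * (1 / P' (c j)) := by
          gcongr
          exact ((Real.log_le_sub_one_of_pos (div_pos h' hq0)).trans (by linarith)).trans hle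
      _ = _ := by ring
  calc mutualInfo p (fun j k => V (c j) k) ≤ ∑ j, ∑ k, p j / P' (c j) * V (c j) k :=
        Finset.sum_le_sum fun j _ => Finset.sum_le_sum fun k _ => hterm j k
    _ = ∑ j, p j / P' (c j) := by simp [← Finset.mul_sum, hV1]
    _ = ∑ y, ∑ j with c j = y, p j / P' (c j) := (Finset.sum_fiberwise _ _ _).symm
    _ = ∑ y, P' y / P' y := by
        refine Finset.sum_congr rfl fun y _ => ?_
        rw [hP', Finset.sum_div]
        exact Finset.sum_congr rfl fun i hi => by rw [(Finset.mem_filter.1 hi).2]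
    _ ≤ ∑ _y : Y, 1 := Finset.sum_le_sum fun y _ => div_self_le_one _
    _ = Fintype.card Y := by simp

/-- A form of Fano's inequality for the uniform distribution on `m + 1` messages: it is Gibbs'
inequality for the guess of the message that gives weight `1 / 2` to the outcome and spreads the
remaining weight `1 / 2` evenly over the other `m` messages. -/
theorem fano_le_mutualInfo {m : ℕ} (hm : 0 < m) (W : Fin (m + 1) → Fin (m + 1) → ℝ)
    (hW : ∀ j k, 0 ≤ W j k) (hW1 : ∀ j, ∑ k, W j k = 1) :
    (1 - (∑ j, (1 - W j j)) / (m + 1)) * Real.log (m + 1) - Real.log 2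
      ≤ mutualInfo (fun _ => ((m : ℝ) + 1)⁻¹) W := by
  have hm' : (0 : ℝ) < m := by exact_mod_cast hm
  set u : ℝ := ((m : ℝ) + 1)⁻¹ with hu
  have hu0 : 0 < u := by positivity
  set q : Fin (m + 1) → ℝ := fun k => ∑ i, u * W i k with hq
  have hq0 : ∀ k, 0 ≤ q k := fun k => Finset.sum_nonneg fun i _ => mul_nonneg hu0.le (hW _ _)
  set r : Fin (m + 1) → Fin (m + 1) → ℝ := fun j k => if j = k then 1 / 2 else 1 / (2 * m) with hr
  have hr0 : ∀ j k, 0 < r j k := fun j k => by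
    simp only [hr]; split_ifs <;> positivity
  have hr1 : ∀ k, ∑ j, r j k = 1 := fun k => by
    have : ∀ j, r j k = 1 / (2 * m) + if j = k then 1 / 2 - 1 / (2 * (m : ℝ)) else 0 := fun j => by
      simp only [hr]; split_ifs <;> ring
    simp only [this, Finset.sum_add_distrib, Finset.sum_ite_eq', Finset.mem_univ, if_true]
    simp only [Finset.sum_const, Finset.card_univ, Fintype.card_fin, nsmul_eq_mul]
    push_cast
    field_simp
    ring
  have hterm : ∀ j k, u * W j k * Real.log (r j k / u) + (u * W j k - q k * r j k)
      ≤ u * W j k * Real.log (W j k / q k) := by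
    intro j k
    rcases (hW j k).eq_or_lt with h | h
    · simp only [← h, mul_zero, zero_mul, zero_sub, zero_add]
      have := mul_nonneg (hq0 k) (hr0 j k).le
      linarith
    have hqk : 0 < q k := (mul_pos hu0 h).trans_le
      (Finset.single_le_sum (f := fun i => u * W i k)
        (fun i _ => mul_nonneg hu0.le (hW _ _)) (Finset.mem_univ j))
    have hlog : Real.log (W j k / q k) - Real.log (r j k / u)
        = -Real.log (q k * r j k / (u * W j k)) := by
      rw [Real.log_div h.ne' hqk.ne', Real.log_div (hr0 j k).ne' hu0.ne',
        Real.log_div (mul_pos hqk (hr0 j k)).ne' (mul_pos hu0 h).ne',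
        Real.log_mul hqk.ne' (hr0 j k).ne', Real.log_mul hu0.ne' h.ne']
      ring
    have hpos : 0 < u * W j k := mul_pos hu0 h
    have h1 := Real.log_le_sub_one_of_pos (div_pos (mul_pos hqk (hr0 j k)) hpos)
    have h2 : u * W j k * (q k * r j k / (u * W j k)) = q k * r j k :=
      mul_div_cancel₀ _ hpos.ne'
    have h3 := mul_le_mul_of_nonneg_left h1 hpos.le
    have h4 := congrArg (fun t => u * W j k * t) hlog
    nlinarith
  have hsumW : ∑ j, ∑ k, u * W j k = 1 := by
    simp only [← Finset.mul_sum, hW1, hu, Finset.sum_const, Finset.card_univ, Fintype.card_fin,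
      nsmul_eq_mul]
    push_cast
    field_simp
  have hsumq : ∑ j, ∑ k, q k * r j k = 1 := by
    rw [Finset.sum_comm]
    simp only [← Finset.mul_sum, hr1, mul_one]
    rw [← hsumW, hq, Finset.sum_comm]
  have hlogr : ∀ j k, Real.log (m + 1) - Real.log 2 - (if j = k then 0 else Real.log (m + 1))
      ≤ Real.log (r j k / u) := by
    intro j k
    rw [Real.log_div (hr0 j k).ne' hu0.ne', hu, Real.log_inv]
    by_cases h : j = k
    · simp only [hr, h, if_true]
      rw [one_div, Real.log_inv]; linarith
    · simp only [hr, h, if_false]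
      rw [one_div, Real.log_inv, Real.log_mul two_ne_zero hm'.ne']
      have := Real.log_le_log hm' (by linarith : (m : ℝ) ≤ m + 1)
      linarith
  have hmain : ∑ j, ∑ k, (u * W j k *
      (Real.log (m + 1) - Real.log 2 - (if j = k then 0 else Real.log (m + 1)))
      + (u * W j k - q k * r j k)) ≤ mutualInfo (fun _ => u) W := by
    refine Finset.sum_le_sum fun j _ => Finset.sum_le_sum fun k _ => le_trans ?_ (hterm j k)
    have := mul_le_mul_of_nonneg_left (hlogr j k) (mul_nonneg hu0.le (hW j k))
    linarith
  refine le_of_eq_of_le ?_ hmain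
  have hrow : ∀ j, ∑ k, W j k * (if j = k then 0 else Real.log (m + 1))
      = (1 - W j j) * Real.log (m + 1) := by
    intro j
    have : ∀ k, W j k * (if j = k then 0 else Real.log (m + 1))
        = W j k * Real.log (m + 1) - if j = k then W j k * Real.log (m + 1) else 0 := fun k => by
      split_ifs <;> ring
    simp only [this, Finset.sum_sub_distrib, ← Finset.sum_mul, hW1, Finset.sum_ite_eq,
      Finset.mem_univ, if_true]
    ring
  simp only [Finset.sum_add_distrib, Finset.sum_sub_distrib, mul_sub, hsumq,
    ← Finset.sum_mul, mul_assoc, ← Finset.mul_sum, hrow, hW1, Finset.sum_const, Finset.card_univ,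
    Fintype.card_fin, nsmul_eq_mul, hu, ← Finset.sum_mul]
  push_cast
  field_simp
  ring

theorem mutualInfo_one_message (W : Fin 1 → Fin 1 → ℝ) :
    mutualInfo (fun _ => 1) W = 0 := by
  rcases eq_or_ne (W 0 0) 0 with h | h <;> simp [mutualInfo, h]

end CQ

/-! ### A measurement from a truncated linear function of the frame operator -/

namespace CQ

section measurement

variable {K : Type*} [NormedAddCommGroup K] [InnerProductSpace ℂ K] [CompleteSpace K]

/-- The constraint on the function `x ↦ max 0 ((3 - x) / 2)`, applied to the frame operator, that
makes the effects sum to at most `1`. The equality at `x = 1` is that of `x ↦ x ^ (-1 / 2)`, whose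
tangent there is `(3 - x) / 2`. -/
theorem mul_truncated_tangent_sq_le_one (x : ℝ) :
    max 0 ((3 - x) / 2) * x * max 0 ((3 - x) / 2) ≤ 1 := by
  rcases le_total ((3 - x) / 2) 0 with h | h
  · simp [max_eq_left h]
  · rw [max_eq_right h]
    nlinarith [mul_nonneg (sq_nonneg (x - 1)) (by linarith : (0 : ℝ) ≤ 4 - x)]

/-- A variant of the pretty good measurement. The inverse square root of the frame operator
`S = ∑ j, |Q vⱼ⟩⟨Q vⱼ|` is replaced by `T = max 0 ((3 - S) / 2)`, which needs no invertibility of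
`S`; the effects are `|Q T Q vⱼ⟩⟨Q T Q vⱼ|`, and what they lack to `1` is added to the first one. -/
theorem exists_povm_one_sub_le {m : ℕ} (v : Fin (m + 1) → K) (Q : K →L[ℂ] K)
    (hQ : IsStarProjection Q) :
    ∃ E : POVM K (m + 1), ∀ j, 1 - (inner ℂ (v j) (E.effect j (v j))).re ≤
      (1 - ‖Q (v j)‖ ^ 2) * (2 - ‖Q (v j)‖ ^ 2)
        + ∑ i with i ≠ j, ‖inner ℂ (Q (v i)) (Q (v j))‖ ^ 2 := by
  set w : Fin (m + 1) → K := fun j => Q (v j) with hw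
  set S : K →L[ℂ] K := ∑ j, InnerProductSpace.rankOne ℂ (w j) (w j) with hS
  have hS0 : 0 ≤ S := Finset.sum_nonneg fun j _ =>
    (ContinuousLinearMap.nonneg_iff_isPositive _).2 (InnerProductSpace.isPositive_rankOne_self _)
  have hSa : IsSelfAdjoint S := hS0.isSelfAdjoint
  set g : ℝ → ℝ := fun x => max 0 ((3 - x) / 2) with hg
  have hgc : Continuous g := by fun_prop
  set T : K →L[ℂ] K := cfc g S with hT
  have hTa : IsSelfAdjoint T := cfc_predicate _ _
  have hTST : T * S * T ≤ 1 := by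
    have h1 : T * S * T = cfc (fun x => g x * x * g x) S := by
      rw [cfc_mul (fun x => g x * x) g S (by fun_prop) hgc.continuousOn,
        cfc_mul g (fun x => x) S hgc.continuousOn (by fun_prop), cfc_id' ℝ S]
    rw [h1]
    exact cfc_le_one _ _ fun x _ => mul_truncated_tangent_sq_le_one x
  have hTlow : (3 / 2 : ℝ) • (1 : K →L[ℂ] K) - (1 / 2 : ℝ) • S ≤ T := by
    have h1 : (3 / 2 : ℝ) • (1 : K →L[ℂ] K) - (1 / 2 : ℝ) • S
        = cfc (fun x : ℝ => 3 / 2 - 1 / 2 * x) S := by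
      rw [cfc_sub (fun _ => 3 / 2) (fun x : ℝ => 1 / 2 * x) S (by fun_prop) (by fun_prop),
        cfc_const_mul (1 / 2 : ℝ) (fun x => x) S (by fun_prop), cfc_id' ℝ S,
        cfc_const (3 / 2 : ℝ) S, Algebra.algebraMap_eq_smul_one]
    rw [h1]
    refine cfc_mono (fun x _ => ?_) (by fun_prop) hgc.continuousOn
    exact le_trans (by linarith) (le_max_right _ _)
  set u : Fin (m + 1) → K := fun j => Q (T (w j)) with hu
  set F : Fin (m + 1) → K →L[ℂ] K := fun j => InnerProductSpace.rankOne ℂ (u j) (u j) with hF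
  have hFpos : ∀ j, (F j).IsPositive := fun j => InnerProductSpace.isPositive_rankOne_self _
  have hFsum : ∑ j, F j = Q * (T * S * T) * Q := by
    have hadjQ : ContinuousLinearMap.adjoint Q = Q := hQ.isSelfAdjoint
    have hadjT : ContinuousLinearMap.adjoint T = T := hTa
    ext x
    change (∑ j, F j) x = Q (T (S (T (Q x))))
    simp only [hF, hS, hu, sum_apply, InnerProductSpace.rankOne_apply, map_sum, map_smul]
    refine Finset.sum_congr rfl fun j _ => ?_
    rw [← ContinuousLinearMap.adjoint_inner_right, hadjQ,
      ← ContinuousLinearMap.adjoint_inner_right, hadjT]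
  have hrem : (1 - ∑ j, F j).IsPositive := by
    rw [← ContinuousLinearMap.nonneg_iff_isPositive, hFsum]
    have h1 : 0 ≤ Q * (1 - T * S * T) * Q := by
      have := star_left_conjugate_nonneg (sub_nonneg.2 hTST) Q
      rwa [hQ.isSelfAdjoint.star_eq] at this
    have h2 : (0 : K →L[ℂ] K) ≤ 1 - Q := hQ.one_sub.nonneg
    have h3 : Q * Q = Q := hQ.isIdempotentElem
    have h4 : 1 - Q * (T * S * T) * Q = (1 - Q) + Q * (1 - T * S * T) * Q := by
      rw [mul_sub, sub_mul, mul_one, h3]; abel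
    rw [h4]
    exact add_nonneg h2 h1
  refine ⟨⟨fun k => F k + if k = 0 then 1 - ∑ j, F j else 0, fun k => ?_, ?_⟩, fun j => ?_⟩
  · split_ifs
    · exact (hFpos k).add hrem
    · simpa using hFpos k
  · simp [Finset.sum_add_distrib]
  · set t := ‖Q (v j)‖ ^ 2 with ht
    set q : ℝ := (inner ℂ (w j) (T (w j))).re with hq
    have h1 : q ^ 2 ≤ (inner ℂ (v j) ((F j) (v j))).re := by
      have hin : inner ℂ (u j) (v j) = inner ℂ (T (w j)) (w j) := by
        have hadjQ : ContinuousLinearMap.adjoint Q = Q := hQ.isSelfAdjoint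
        simp only [hu, hw]
        rw [← ContinuousLinearMap.adjoint_inner_right, hadjQ]
      have hval : inner ℂ (v j) ((F j) (v j)) = ((‖inner ℂ (u j) (v j)‖ ^ 2 : ℝ) : ℂ) := by
        simp only [hF, InnerProductSpace.rankOne_apply, inner_smul_right]
        rw [← inner_conj_symm (v j) (u j), Complex.mul_conj, Complex.normSq_eq_norm_sq]
      rw [hval, Complex.ofReal_re, hin, ← sq_abs, hq, ← inner_conj_symm, Complex.conj_re]
      gcongr
      exact Complex.abs_re_le_norm _
    have h2 : (inner ℂ (v j) ((F j) (v j))).re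
        ≤ (inner ℂ (v j) ((F j + if j = 0 then 1 - ∑ i, F i else 0) (v j))).re := by
      rw [add_apply, inner_add_right, Complex.add_re]
      have : 0 ≤ (inner ℂ (v j) ((if j = 0 then 1 - ∑ i, F i else 0) (v j))).re := by
        split_ifs
        · exact hrem.re_inner_nonneg_right (v j)
        · simp
      linarith
    have h3 : 3 / 2 * t - 1 / 2 * (t ^ 2 + ∑ i with i ≠ j, ‖inner ℂ (w i) (w j)‖ ^ 2) ≤ q := by
      have hp := (ContinuousLinearMap.le_def _ _).1 hTlow
      have h := hp.re_inner_nonneg_right (w j)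
      have hS' : inner ℂ (w j) (S (w j)) = ((∑ i, ‖inner ℂ (w i) (w j)‖ ^ 2 : ℝ) : ℂ) := by
        simp only [hS, sum_apply, InnerProductSpace.rankOne_apply, inner_sum,
          inner_smul_right, Complex.ofReal_sum]
        refine Finset.sum_congr rfl fun i _ => ?_
        rw [← inner_conj_symm (w j) (w i), Complex.mul_conj, Complex.normSq_eq_norm_sq]
      have hsplit : ∑ i, ‖inner ℂ (w i) (w j)‖ ^ 2
          = t ^ 2 + ∑ i with i ≠ j, ‖inner ℂ (w i) (w j)‖ ^ 2 := by
        rw [Finset.filter_ne', ← Finset.add_sum_erase _ _ (Finset.mem_univ j),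
          inner_self_eq_norm_sq_to_K]
        simp [ht, hw]
      rw [← hsplit]
      simp only [sub_apply, smul_apply,
        one_apply_eq_self, inner_sub_right, inner_smul_right_eq_smul, hS',
        inner_self_eq_norm_sq_to_K, RCLike.re_eq_complex_re] at h
      rw [Complex.sub_re, Complex.sub_re, Complex.smul_re, Complex.smul_re, Complex.ofReal_re, ← hq]
        at h
      have h' : (((‖w j‖ : ℝ) : ℂ) ^ 2).re = t := by
        rw [← Complex.ofReal_pow, Complex.ofReal_re]
      erw [h'] at h
      simp only [smul_eq_mul] at h
      linarith
    change 1 - (inner ℂ (v j) ((F j + if j = 0 then 1 - ∑ i, F i else 0) (v j))).re ≤ _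
    -- The success probability is at least `q ^ 2 ≥ 2 * q - 1`.
    nlinarith [sq_nonneg (q - 1)]

end measurement

end CQ

/-! ### Spectral decomposition of the average state and the trace of its powers -/

namespace CQ

section spectral

variable {H : Type*} [NormedAddCommGroup H] [InnerProductSpace ℂ H]
  {ι : Type*} [Fintype ι]

/-- The operator with eigenvalues `μ k` on the family `e` and `0` on its orthogonal complement. -/
noncomputable def diagOp (e : ι → H) (μ : ι → ℝ) : H →L[ℂ] H :=
  ∑ k, (μ k : ℂ) • InnerProductSpace.rankOne ℂ (e k) (e k)

theorem diagOp_apply (e : ι → H) (μ : ι → ℝ) (x : H) :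
    diagOp e μ x = ∑ k, (μ k : ℂ) • inner ℂ (e k) x • e k := by
  simp [diagOp, sum_apply]

theorem diagOp_mul {e : ι → H} (he : Orthonormal ℂ e) (μ ν : ι → ℝ) :
    diagOp e μ * diagOp e ν = diagOp e (μ * ν) := by
  classical
  ext x
  change diagOp e μ (diagOp e ν x) = _
  simp only [diagOp_apply, inner_sum, inner_smul_right, orthonormal_iff_ite.1 he]
  refine Finset.sum_congr rfl fun k _ => ?_
  simp [smul_smul]
  ring_nf

theorem inner_diagOp (e : ι → H) (μ : ι → ℝ) (x y : H) :
    inner ℂ x (diagOp e μ y) = ∑ k, (μ k : ℂ) * (inner ℂ x (e k) * inner ℂ (e k) y) := by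
  simp only [diagOp_apply, inner_sum, inner_smul_right]
  exact Finset.sum_congr rfl fun k _ => by ring

theorem diagOp_nonneg (e : ι → H) {μ : ι → ℝ} (hμ : ∀ k, 0 ≤ μ k) : 0 ≤ diagOp e μ :=
  (ContinuousLinearMap.nonneg_iff_isPositive _).2 <| ContinuousLinearMap.isPositive_sum _ fun k _ =>
    (InnerProductSpace.isPositive_rankOne_self _).smul_of_nonneg (by exact_mod_cast hμ k)

theorem aeval_diagOp {e : ι → H} (he : Orthonormal ℂ e) (μ : ι → ℝ)
    (q : Polynomial ℝ) : Polynomial.aeval (diagOp e μ) q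
      = q.eval 0 • 1 + diagOp e (fun k => q.eval (μ k) - q.eval 0) := by
  have hpow : ∀ j : ℕ, diagOp e μ ^ (j + 1) = diagOp e (μ ^ (j + 1)) := by
    intro j
    induction j with
    | zero => simp
    | succ j ih => rw [pow_succ, ih, diagOp_mul he, ← pow_succ]
  induction q using Polynomial.induction_on with
  | C r => ext x; simp [diagOp_apply, Algebra.algebraMap_eq_smul_one]
  | add p q hp hq =>
    rw [map_add, hp, hq]
    ext x
    simp only [Polynomial.eval_add, add_apply, smul_apply, diagOp_apply, add_smul,
      one_apply_eq_self]
    rw [add_add_add_comm, ← Finset.sum_add_distrib]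
    congr 1
    refine Finset.sum_congr rfl fun k _ => ?_
    rw [← add_smul]
    push_cast
    ring_nf
  | monomial j r _ =>
    rw [map_mul, map_pow, Polynomial.aeval_C, Polynomial.aeval_X, hpow]
    ext x
    simp [diagOp_apply, Algebra.algebraMap_eq_smul_one, Finset.smul_sum, smul_smul]
    refine Finset.sum_congr rfl fun k _ => ?_
    rw [← Complex.coe_smul, smul_smul, mul_assoc]

variable [CompleteSpace H]

/-- The spectrum is finite, so the functional calculus of the power function is that of a
polynomial which interpolates it. -/
theorem diagOp_rpow {e : ι → H} (he : Orthonormal ℂ e) {μ : ι → ℝ} (hμ : ∀ k, 0 ≤ μ k)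
    {r : ℝ} (hr : 0 < r) : diagOp e μ ^ r = diagOp e (fun k => μ k ^ r) := by
  classical
  set F : Finset ℝ := insert 0 (Finset.univ.image μ) with hF
  have hμF : ∀ k, μ k ∈ F := fun k => by simp [hF]
  have h0F : (0 : ℝ) ∈ F := by simp [hF]
  have hspec : ∀ x ∈ spectrum ℝ (diagOp e μ), x ∈ F := by
    intro x hx
    by_contra hxF
    set p : Polynomial ℝ := ∏ a ∈ F, (Polynomial.X - Polynomial.C a) with hp
    have hp0 : ∀ a ∈ F, p.eval a = 0 := fun a ha => by
      rw [hp, Polynomial.eval_prod]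
      exact Finset.prod_eq_zero ha (by simp)
    have hpx : p.eval x ≠ 0 := by
      rw [hp, Polynomial.eval_prod]
      refine Finset.prod_ne_zero_iff.2 fun a ha => ?_
      simp only [Polynomial.eval_sub, Polynomial.eval_X, Polynomial.eval_C]
      exact sub_ne_zero.2 fun h => hxF (h ▸ ha)
    have hA : Polynomial.aeval (diagOp e μ) p = 0 := by
      rw [aeval_diagOp he]
      ext x
      simp [diagOp_apply, hp0 _ h0F, hp0 _ (hμF _)]
    have := spectrum.subset_polynomial_aeval (diagOp e μ) p ⟨x, hx, rfl⟩
    rw [hA, spectrum.mem_iff, sub_zero] at this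
    exact this ((isUnit_iff_ne_zero.2 hpx).map _)
  set q : Polynomial ℝ := Lagrange.interpolate F id (fun x => x ^ r) with hq
  have hqF : ∀ a ∈ F, q.eval a = a ^ r := fun a ha =>
    Lagrange.eval_interpolate_at_node (v := id) _ (Function.injective_id.injOn) ha
  have hnn := diagOp_nonneg e hμ
  rw [CFC.rpow_eq_cfc_real (ha := hnn),
    cfc_congr (g := q.eval) (fun x hx => (hqF x (hspec x hx)).symm),
    cfc_polynomial q _ hnn.isSelfAdjoint, aeval_diagOp he]
  simp [hqF _ (hμF _), hqF _ h0F, Real.zero_rpow hr.ne']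

theorem opTrace_diagOp {e : ι → H} (he : Orthonormal ℂ e) (μ : ι → ℝ) :
    opTrace (diagOp e μ) = ((∑ k, μ k : ℝ) : ℂ) := by
  unfold opTrace
  generalize (exists_hilbertBasis ℂ H).choose_spec.choose = b
  refine HasSum.tsum_eq ?_
  simp only [diagOp_apply, inner_sum, inner_smul_right, Complex.ofReal_sum]
  refine hasSum_sum fun k _ => ?_
  have h := (b.hasSum_inner_mul_inner (e k) (e k)).mul_left (μ k : ℂ)
  simpa [inner_self_eq_norm_sq_to_K, he.1 k] using h

end spectral

section avgState

variable {X : Type*} [Fintype X] {H : Type*} [NormedAddCommGroup H] [InnerProductSpace ℂ H]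

theorem avgState_apply (ψ : X → H) (P : X → ℝ) (y : H) :
    avgState ψ P y = ∑ x, (P x : ℂ) • inner ℂ (ψ x) y • ψ x := by
  simp [avgState, sum_apply]

theorem inner_avgState (ψ : X → H) (P : X → ℝ) (y z : H) :
    inner ℂ y (avgState ψ P z) = ∑ x, (P x : ℂ) * (inner ℂ y (ψ x) * inner ℂ (ψ x) z) := by
  simp only [avgState_apply, inner_sum, inner_smul_right]
  exact Finset.sum_congr rfl fun x _ => by ring

theorem avgState_isPositive (ψ : X → H) {P : X → ℝ} (hP : ∀ x, 0 ≤ P x) :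
    (avgState ψ P).IsPositive :=
  ContinuousLinearMap.isPositive_sum _ fun x _ =>
    (InnerProductSpace.isPositive_rankOne_self _).smul_of_nonneg (by exact_mod_cast hP x)

/-- The span of the signal states, which supports every average state. -/
abbrev signalSpan (ψ : X → H) : Submodule ℂ H := Submodule.span ℂ (Set.range ψ)

instance (ψ : X → H) : FiniteDimensional ℂ (signalSpan ψ) :=
  FiniteDimensional.span_of_finite ℂ (Set.finite_range ψ)

/-- The spectral decomposition of the average state on the span of the signal states. The number of
eigenvalues, counted with multiplicity and including zeros, does not depend on `P`. -/
theorem exists_avgState_eq_diagOp (ψ : X → H) (hψ : ∀ x, ‖ψ x‖ = 1) {P : X → ℝ}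
    (hP : P ∈ stdSimplex ℝ X) :
    ∃ (e : OrthonormalBasis (Fin (Module.finrank ℂ (signalSpan ψ))) ℂ (signalSpan ψ))
      (μ : Fin (Module.finrank ℂ (signalSpan ψ)) → ℝ), μ ∈ stdSimplex ℝ _ ∧
        avgState ψ P = diagOp (fun k => (e k : H)) μ := by
  set K := signalSpan ψ
  have hmem : ∀ x, ψ x ∈ K := fun x => Submodule.subset_span ⟨x, rfl⟩
  have hmap : ∀ y, avgState ψ P y ∈ K := fun y => by
    rw [avgState_apply]
    exact Submodule.sum_mem _ fun x _ => K.smul_mem _ (K.smul_mem _ (hmem x))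
  have hpos := avgState_isPositive ψ hP.1
  set A : K →ₗ[ℂ] K := (avgState ψ P).toLinearMap.restrict fun y _ => hmap y with hA
  have hsym : A.IsSymmetric := fun y z => hpos.isSymmetric (y : H) (z : H)
  set e := hsym.eigenvectorBasis rfl
  set μ := hsym.eigenvalues rfl
  have he : ∀ k, avgState ψ P (e k : H) = (μ k : ℂ) • (e k : H) := fun k =>
    congrArg Subtype.val (hsym.apply_eigenvectorBasis rfl k)
  have hμ : ∀ k, μ k = ∑ x, P x * ‖inner ℂ (e k : H) (ψ x)‖ ^ 2 := fun k => by
    have h : inner ℂ (e k : H) (avgState ψ P (e k : H)) = μ k := by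
      have hn : ‖(e k : H)‖ = 1 := e.orthonormal.1 k
      rw [he, inner_smul_right, inner_self_eq_norm_sq_to_K, hn]
      simp
    rw [inner_avgState] at h
    have h' : ((μ k : ℝ) : ℂ) = ((∑ x, P x * ‖inner ℂ (e k : H) (ψ x)‖ ^ 2 : ℝ) : ℂ) := by
      rw [← h, Complex.ofReal_sum]
      refine Finset.sum_congr rfl fun x _ => ?_
      rw [← inner_conj_symm (ψ x) (e k : H), Complex.mul_conj, Complex.normSq_eq_norm_sq]
      push_cast; rfl
    exact_mod_cast h'
  refine ⟨e, μ, ⟨fun k => ?_, ?_⟩, ?_⟩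
  · rw [hμ]
    exact Finset.sum_nonneg fun x _ => mul_nonneg (hP.1 x) (sq_nonneg _)
  · simp only [hμ]
    rw [Finset.sum_comm]
    simp only [← Finset.mul_sum]
    have h : ∀ x, ∑ k, ‖inner ℂ (e k : H) (ψ x)‖ ^ 2 = 1 := fun x => by
      have := e.sum_sq_norm_inner_right ⟨ψ x, hmem x⟩
      simpa [hψ x] using this
    simp only [h, mul_one, hP.2]
  · ext y
    have h := congrArg Subtype.val (e.sum_repr' ⟨avgState ψ P y, hmap y⟩)
    simp only [Submodule.coe_sum, Submodule.coe_smul, Submodule.coe_inner] at h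
    rw [← h, diagOp_apply]
    refine Finset.sum_congr rfl fun k _ => ?_
    rw [← hpos.inner_left_eq_inner_right, he, inner_smul_left, Complex.conj_ofReal, smul_smul]

variable [CompleteSpace H]

/-- The quantity `Tr ρ^{1+s}`. -/
noncomputable def powTrace (ψ : X → H) (s : ℝ) (P : X → ℝ) : ℝ :=
  (opTrace (avgState ψ P ^ (1 + s))).re

theorem powTrace_eq_sum {ψ : X → H} {P : X → ℝ} {n : ℕ} {e : Fin n → H} (he : Orthonormal ℂ e)
    {μ : Fin n → ℝ} (hμ : ∀ k, 0 ≤ μ k) (h : avgState ψ P = diagOp e μ) {s : ℝ} (hs : 0 ≤ s) :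
    powTrace ψ s P = ∑ k, μ k ^ (1 + s) := by
  rw [powTrace, h, diagOp_rpow he hμ (by linarith), opTrace_diagOp he, Complex.ofReal_re]

theorem continuousOn_powTrace (ψ : X → H) (hψ : ∀ x, ‖ψ x‖ = 1) {s : ℝ} (hs : 0 ≤ s) :
    ContinuousOn (powTrace ψ s) (stdSimplex ℝ X) := by
  -- The trace can be taken in an orthonormal basis of `signalSpan ψ`, the same for all `P`.
  set b := stdOrthonormalBasis ℂ (signalSpan ψ)
  have hEq : Set.EqOn (powTrace ψ s)
      (fun P => (∑ l, inner ℂ (b l : H) ((avgState ψ P ^ (1 + s)) (b l : H))).re)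
      (stdSimplex ℝ X) := by
    intro P hP
    obtain ⟨e, μ, hμ, h⟩ := exists_avgState_eq_diagOp ψ hψ hP
    have he : Orthonormal ℂ (fun k => (e k : H)) := e.orthonormal.comp_linearIsometry
      (signalSpan ψ).subtypeₗᵢ
    simp only
    rw [powTrace_eq_sum he hμ.1 h hs, h, diagOp_rpow he hμ.1 (by linarith)]
    simp only [diagOp_apply, inner_sum, inner_smul_right]
    rw [Finset.sum_comm]
    have hk : ∀ k, ∑ l, inner ℂ (e k : H) (b l : H) * inner ℂ (b l : H) (e k : H) = 1 := fun k => by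
      have := b.sum_inner_mul_inner (e k) (e k)
      simp only [Submodule.coe_inner] at this
      rw [this, inner_self_eq_norm_sq_to_K, he.1 k]
      simp
    simp only [← Finset.mul_sum, hk, mul_one]
    rw [← Complex.ofReal_sum, Complex.ofReal_re]
  refine ContinuousOn.congr ?_ hEq
  have hρ : Continuous (fun P : X → ℝ => avgState ψ P) := by
    unfold avgState; fun_prop
  have hpow : ContinuousOn (fun P : X → ℝ => avgState ψ P ^ (1 + s)) (stdSimplex ℝ X) := by
    simp only [CFC.rpow_def]
    refine ContinuousOn.cfc_nnreal_of_mem_nhdsSet (s := Set.univ) _ Filter.univ_mem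
      hρ.continuousOn (fun P hP => ?_) ?_
    · exact (ContinuousLinearMap.nonneg_iff_isPositive _).2 (avgState_isPositive ψ hP.1)
    · exact (NNReal.continuous_rpow_const (by linarith)).continuousOn
  refine Complex.continuous_re.comp_continuousOn (continuousOn_finsetSum _ fun l _ => ?_)
  exact (innerSL ℂ (b l : H)).continuous.comp_continuousOn (hpow.clm_apply continuousOn_const)

end avgState

end CQ

/-! ### Random coding -/

namespace CQ

theorem sum_pi_prod {Y : Type*} [Fintype Y] {M : ℕ} {R : Type*} [CommRing R]
    (F : Fin M → Y → R) :
    ∑ c : Fin M → Y, ∏ l, F l (c l) = ∏ l, ∑ y, F l y := by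
  classical
  rw [Finset.prod_univ_sum, Fintype.piFinset_univ]

/-- The joint law of two distinct letters of a word with independent letters. -/
theorem sum_pi_mul_pair {Y : Type*} [Fintype Y] {M : ℕ} {Q : Y → ℝ} (hQ : ∑ y, Q y = 1)
    {i j : Fin M} (hij : i ≠ j) (f : Y → Y → ℝ) :
    ∑ c : Fin M → Y, (∏ l, Q (c l)) * f (c i) (c j) = ∑ y, ∑ z, Q y * Q z * f y z := by
  classical
  have hprod : ∀ g h : Y → ℝ, ∑ c : Fin M → Y, (∏ l, Q (c l)) * (g (c i) * h (c j))
      = (∑ y, Q y * g y) * ∑ z, Q z * h z := by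
    intro g h
    have h1 : ∀ c : Fin M → Y, (∏ l, Q (c l)) * (g (c i) * h (c j))
        = ∏ l, Q (c l) * ((if l = i then g (c l) else 1) * (if l = j then h (c l) else 1)) := by
      intro c
      rw [Finset.prod_mul_distrib, Finset.prod_mul_distrib, Finset.prod_ite_eq',
        Finset.prod_ite_eq']
      simp
    have h2 : ∀ l, ∑ y, Q y * ((if l = i then g y else 1) * (if l = j then h y else 1))
        = (if l = i then ∑ y, Q y * g y else 1) * (if l = j then ∑ y, Q y * h y else 1) := by
      intro l
      by_cases hi : l = i
      · have hj : l ≠ j := fun hj => hij (hi.symm.trans hj)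
        simp [hi, hij]
      · by_cases hj : l = j
        · simp [hj, hij.symm]
        · simp [hi, hj, hQ]
    simp only [h1]
    rw [sum_pi_prod (fun l y => Q y * ((if l = i then g y else 1) * (if l = j then h y else 1)))]
    simp only [h2]
    rw [Finset.prod_mul_distrib, Finset.prod_ite_eq', Finset.prod_ite_eq']
    simp
  have hf : ∀ c : Fin M → Y, (∏ l, Q (c l)) * f (c i) (c j)
      = ∑ y, ∑ z, f y z * ((∏ l, Q (c l)) *
          ((if c i = y then 1 else 0) * (if c j = z then 1 else 0))) := by
    intro c
    simp [mul_comm]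
  simp only [hf]
  rw [Finset.sum_comm]
  refine Finset.sum_congr rfl fun y _ => ?_
  rw [Finset.sum_comm]
  refine Finset.sum_congr rfl fun z _ => ?_
  rw [← Finset.mul_sum,
    hprod (fun x => if x = y then 1 else 0) (fun x => if x = z then 1 else 0)]
  simp only [mul_ite, mul_one, mul_zero, Finset.sum_ite_eq', Finset.mem_univ, if_true]
  ring

/-- A function is somewhere at most its average. -/
theorem exists_le_of_weighted_sum_eq {C : Type*} [Fintype C] {w f : C → ℝ} (hw : ∀ c, 0 ≤ w c)
    (hw1 : ∑ c, w c = 1) {a : ℝ} (h : ∑ c, w c * f c = a) : ∃ c, f c ≤ a := by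
  by_contra! hlt
  have h0 : ∑ c, w c * (f c - a) = 0 := by
    simp only [mul_sub, Finset.sum_sub_distrib, ← Finset.sum_mul, h, hw1]; ring
  have hz := (Finset.sum_eq_zero_iff_of_nonneg fun c _ =>
    mul_nonneg (hw c) (sub_nonneg.2 (hlt c).le)).1 h0
  have : ∑ c, w c = 0 := Finset.sum_eq_zero fun c hc =>
    (mul_eq_zero.1 (hz c hc)).resolve_right (sub_pos.2 (hlt c)).ne'
  linarith

/-- Burnashev and Holevo's random coding bound for a finite ensemble of pure states whose average
state has eigenvectors `e` and eigenvalues `μ`. The codewords are drawn independently, and the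
measurement is that of `exists_povm_one_sub_le` for the projection onto the eigenvectors with
`m * μ a ≤ 1`. The mean error is then at most the sum of `2 * μ a` over the other eigenvectors and
of `m * μ a ^ 2` over these, and both are at most `2 * m ^ s * μ a ^ (1 + s)`. -/
theorem exists_code_error_le {K : Type*} [NormedAddCommGroup K] [InnerProductSpace ℂ K]
    [CompleteSpace K] {Y ι : Type*} [Fintype Y] [Fintype ι] {Q : Y → ℝ}
    (hQ : Q ∈ stdSimplex ℝ Y) {Ψ : Y → K} (hΨ : ∀ y, ‖Ψ y‖ = 1) {e : ι → K}
    (he : Orthonormal ℂ e) {μ : ι → ℝ} (hμ : μ ∈ stdSimplex ℝ ι)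
    (hdiag : ∀ a, ∑ y, (Q y : ℂ) * (inner ℂ (e a) (Ψ y) * inner ℂ (Ψ y) (e a)) = μ a)
    (hoff : ∀ a b, a ≠ b →
      ∑ y, (Q y : ℂ) * (inner ℂ (e a) (Ψ y) * inner ℂ (Ψ y) (e b)) = 0)
    {m : ℕ} (hm : 0 < m) {s : ℝ} (hs : s ∈ Set.Icc (0 : ℝ) 1) :
    ∃ (c : Fin (m + 1) → Y) (E : POVM K (m + 1)),
      (∑ j, (1 - (inner ℂ (Ψ (c j)) (E.effect j (Ψ (c j)))).re)) / (m + 1)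
        ≤ 2 * (m : ℝ) ^ s * ∑ a, μ a ^ (1 + s) := by
  classical
  have hm' : (0 : ℝ) < m := by exact_mod_cast hm
  set χ : ι → ℝ := fun a => if m * μ a ≤ 1 then 1 else 0 with hχ
  have hχχ : χ * χ = χ := by
    ext a; simp only [hχ, Pi.mul_apply]; split_ifs <;> simp
  have hχ0 : ∀ a, 0 ≤ χ a := fun a => by simp only [hχ]; split_ifs <;> simp
  set B : K →L[ℂ] K := diagOp e χ with hB
  have hproj : IsStarProjection B :=
    ⟨by rw [IsIdempotentElem, hB, diagOp_mul he, hχχ], (diagOp_nonneg e hχ0).isSelfAdjoint⟩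
  have hinner : ∀ x y, inner ℂ (B x) (B y)
      = ∑ a, (χ a : ℂ) * (inner ℂ x (e a) * inner ℂ (e a) y) := by
    intro x y
    have hadj : ContinuousLinearMap.adjoint B = B := hproj.isSelfAdjoint
    rw [← ContinuousLinearMap.adjoint_inner_right, hadj, ← inner_diagOp, ← hB]
    have hidem : B * B = B := hproj.isIdempotentElem
    exact congrArg (fun A : K →L[ℂ] K => inner ℂ x (A y)) hidem
  -- The mean of `‖B Ψ‖ ^ 2`.
  have hmean1 : ∑ y, Q y * ‖B (Ψ y)‖ ^ 2 = ∑ a, χ a * μ a := by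
    have h : ((∑ y, Q y * ‖B (Ψ y)‖ ^ 2 : ℝ) : ℂ) = ((∑ a, χ a * μ a : ℝ) : ℂ) := by
      push_cast
      have h1 : ∀ y, ((‖B (Ψ y)‖ : ℝ) : ℂ) ^ 2
          = ∑ a, (χ a : ℂ) * (inner ℂ (Ψ y) (e a) * inner ℂ (e a) (Ψ y)) := fun y => by
        rw [← hinner, inner_self_eq_norm_sq_to_K]; rfl
      simp only [h1, Finset.mul_sum]
      rw [Finset.sum_comm]
      refine Finset.sum_congr rfl fun a _ => ?_
      rw [← hdiag a, Finset.mul_sum]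
      exact Finset.sum_congr rfl fun y _ => by ring
    exact_mod_cast h
  -- The mean squared overlap of two independent projected codewords.
  have hmean2 : ∑ y, ∑ z, Q y * Q z * ‖inner ℂ (B (Ψ y)) (B (Ψ z))‖ ^ 2
      = ∑ a, χ a * μ a ^ 2 := by
    have h : ((∑ y, ∑ z, Q y * Q z * ‖inner ℂ (B (Ψ y)) (B (Ψ z))‖ ^ 2 : ℝ) : ℂ)
        = ((∑ a, χ a * μ a ^ 2 : ℝ) : ℂ) := by
      have h1 : ∀ y z, ((‖inner ℂ (B (Ψ y)) (B (Ψ z))‖ : ℝ) : ℂ) ^ 2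
          = ∑ a, ∑ b, (χ a : ℂ) * χ b * ((inner ℂ (e b) (Ψ y) * inner ℂ (Ψ y) (e a)) *
            (inner ℂ (e a) (Ψ z) * inner ℂ (Ψ z) (e b))) := fun y z => by
        rw [← Complex.mul_conj', hinner, map_sum, Finset.sum_mul_sum]
        refine Finset.sum_congr rfl fun a _ => Finset.sum_congr rfl fun b _ => ?_
        simp only [map_mul, inner_conj_symm, Complex.conj_ofReal]
        ring
      push_cast
      simp only [h1]
      calc ∑ y, ∑ z, (Q y : ℂ) * Q z * ∑ a, ∑ b, (χ a : ℂ) * χ b *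
            ((inner ℂ (e b) (Ψ y) * inner ℂ (Ψ y) (e a)) *
            (inner ℂ (e a) (Ψ z) * inner ℂ (Ψ z) (e b)))
          = ∑ a, ∑ b, (χ a : ℂ) * χ b *
            ((∑ y, (Q y : ℂ) * (inner ℂ (e b) (Ψ y) * inner ℂ (Ψ y) (e a))) *
            ∑ z, (Q z : ℂ) * (inner ℂ (e a) (Ψ z) * inner ℂ (Ψ z) (e b))) := by
            simp only [Finset.sum_mul_sum]
            simp only [Finset.mul_sum]
            rw [Finset.sum_congr rfl fun y _ => Finset.sum_comm]
            rw [Finset.sum_comm]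
            refine Finset.sum_congr rfl fun a _ => ?_
            rw [Finset.sum_congr rfl fun y _ => Finset.sum_comm]
            rw [Finset.sum_comm]
            refine Finset.sum_congr rfl fun b _ => Finset.sum_congr rfl fun y _ =>
              Finset.sum_congr rfl fun z _ => ?_
            ring
        _ = ∑ a, (χ a : ℂ) * (μ a : ℂ) ^ 2 := by
            refine Finset.sum_congr rfl fun a _ => ?_
            rw [Finset.sum_eq_single a]
            · rw [hdiag a]
              have : (χ a : ℂ) * χ a = χ a := by
                have := congrFun hχχ a
                rw [Pi.mul_apply] at this
                exact_mod_cast this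
              rw [this]; ring
            · intro b _ hb
              rw [hoff b a hb]; ring
            · simp
    exact_mod_cast h
  -- The error of a code, with the single-codeword term split evenly over the other `m` codewords.
  set f : Y → Y → ℝ := fun y z => 2 / m * (1 - ‖B (Ψ z)‖ ^ 2)
    + ‖inner ℂ (B (Ψ y)) (B (Ψ z))‖ ^ 2 with hf
  set D : ℝ := ∑ y, ∑ z, Q y * Q z * f y z with hD
  have hDval : D = 2 / m * (1 - ∑ a, χ a * μ a) + ∑ a, χ a * μ a ^ 2 := by
    simp only [hD, hf, mul_add, Finset.sum_add_distrib, hmean2, add_left_inj]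
    rw [← hmean1]
    have : ∀ y z, Q y * Q z * (2 / m * (1 - ‖B (Ψ z)‖ ^ 2))
        = Q y * (2 / m * (Q z - Q z * ‖B (Ψ z)‖ ^ 2)) := fun y z => by ring
    simp only [this, ← Finset.mul_sum, ← Finset.sum_mul, hQ.2, Finset.sum_sub_distrib, one_mul]
  obtain ⟨c, hc⟩ : ∃ c : Fin (m + 1) → Y,
      ∑ j, ∑ i with i ≠ j, f (c i) (c j) ≤ (m + 1) * (m * D) := by
    refine exists_le_of_weighted_sum_eq (w := fun c => ∏ l, Q (c l))
      (fun c => Finset.prod_nonneg fun l _ => hQ.1 _) ?_ ?_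
    · rw [sum_pi_prod (fun _ => Q)]; simp [hQ.2]
    · simp only [Finset.mul_sum]
      rw [Finset.sum_comm]
      have : ∀ j : Fin (m + 1), ∑ c : Fin (m + 1) → Y, ∑ i with i ≠ j,
          (∏ l, Q (c l)) * f (c i) (c j) = m * D := by
        intro j
        rw [Finset.sum_comm, Finset.sum_congr rfl fun i hi =>
          sum_pi_mul_pair hQ.2 (Finset.mem_filter.1 hi).2 f]
        simp [Finset.filter_ne', hD]
      simp [this]
  obtain ⟨E, hE⟩ := exists_povm_one_sub_le (fun j => Ψ (c j)) B hproj
  refine ⟨c, E, ?_⟩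
  have herr : ∑ j, (1 - (inner ℂ (Ψ (c j)) (E.effect j (Ψ (c j)))).re)
      ≤ ∑ j, ∑ i with i ≠ j, f (c i) (c j) := by
    refine Finset.sum_le_sum fun j _ => (hE j).trans ?_
    simp only [hf, Finset.sum_add_distrib]
    gcongr
    have hcard : ∑ i : Fin (m + 1) with i ≠ j, 2 / (m : ℝ) * (1 - ‖B (Ψ (c j))‖ ^ 2)
        = 2 * (1 - ‖B (Ψ (c j))‖ ^ 2) := by
      simp [Finset.filter_ne']
      field_simp
    rw [hcard]
    have hle : ‖B (Ψ (c j))‖ ≤ 1 := by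
      have := B.le_opNorm (Ψ (c j))
      rw [hΨ, mul_one] at this
      exact this.trans hproj.norm_le
    have h0 : 0 ≤ ‖B (Ψ (c j))‖ ^ 2 := sq_nonneg _
    have h1 : ‖B (Ψ (c j))‖ ^ 2 ≤ 1 := pow_le_one₀ (norm_nonneg _) hle
    nlinarith [mul_nonneg h0 (sub_nonneg.2 h1)]
  have hbound : m * D ≤ 2 * (m : ℝ) ^ s * ∑ a, μ a ^ (1 + s) := by
    have h1 : m * D = ∑ a, (2 * (μ a - χ a * μ a) + m * (χ a * μ a ^ 2)) := by
      rw [hDval, Finset.sum_add_distrib, ← Finset.mul_sum, ← Finset.mul_sum,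
        Finset.sum_sub_distrib, hμ.2]
      field_simp
    rw [h1, Finset.mul_sum]
    refine Finset.sum_le_sum fun a _ => ?_
    have ha := hμ.1 a
    have hma : 0 ≤ m * μ a := mul_nonneg hm'.le ha
    have h2 : 2 * (m : ℝ) ^ s * μ a ^ (1 + s) = 2 * (μ a * (m * μ a) ^ s) := by
      rw [Real.rpow_add_of_nonneg ha zero_le_one hs.1, Real.rpow_one,
        Real.mul_rpow hm'.le ha]
      ring
    rw [h2]
    by_cases h : m * μ a ≤ 1
    · have h3 : m * μ a ≤ (m * μ a) ^ s := by
        simpa using Real.rpow_le_rpow_of_exponent_ge' hma h hs.1 hs.2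
      have h4 := mul_le_mul_of_nonneg_left h3 ha
      have h5 := mul_nonneg ha (hma.trans h3)
      simp only [hχ, h, if_true]
      nlinarith
    · have h3 : 1 ≤ (m * μ a) ^ s := Real.one_le_rpow (le_of_not_ge h) hs.1
      have h4 := mul_le_mul_of_nonneg_left h3 ha
      simp only [hχ, h, if_false]
      linarith
  rw [div_le_iff₀ (by positivity)]
  calc _ ≤ (m + 1) * (m * D) := herr.trans hc
    _ ≤ (m + 1) * (2 * (m : ℝ) ^ s * ∑ a, μ a ^ (1 + s)) := by gcongr
    _ = _ := by ring

section product

variable {X : Type*} {H : Type*} [NormedAddCommGroup H] [InnerProductSpace ℂ H]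

theorem inner_productVector : ∀ (N : ℕ) (v w : Fin N → H),
    inner ℂ (productVector N v) (productVector N w) = ∏ i, inner ℂ (v i) (w i)
  | 0, v, w => by
    change inner ℂ (EuclideanSpace.single PUnit.unit (1 : ℂ))
      (EuclideanSpace.single PUnit.unit 1) = _
    simp
  | n + 1, v, w => by
    rw [Fin.prod_univ_succ, ← inner_productVector n]
    exact (UniformSpace.Completion.inner_coe _ _).trans (TensorProduct.inner_tmul _ _ _ _ _)

theorem norm_productVector {N : ℕ} {v : Fin N → H} (hv : ∀ i, ‖v i‖ = 1) :
    ‖productVector N v‖ = 1 := by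
  have h := inner_productVector N v v
  simp only [inner_self_eq_norm_sq_to_K, hv] at h
  have h' : ‖productVector N v‖ ^ 2 = 1 := by
    have : ((‖productVector N v‖ ^ 2 : ℝ) : ℂ) = 1 := by simpa using h
    exact_mod_cast this
  exact (pow_eq_one_iff_of_nonneg (norm_nonneg _) two_ne_zero).1 h'

theorem orthonormal_productVector {ι : Type*} {N : ℕ} {e : ι → H} (he : Orthonormal ℂ e) :
    Orthonormal ℂ (fun a : Fin N → ι => productVector N fun i => e (a i)) := by
  refine ⟨fun a => norm_productVector fun i => he.1 _, fun a b hab => ?_⟩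
  obtain ⟨i, hi⟩ := Function.ne_iff.1 hab
  simp only [inner_productVector]
  exact Finset.prod_eq_zero (Finset.mem_univ i) (he.2 hi)

theorem prod_mem_stdSimplex [Fintype X] {P : X → ℝ} (hP : P ∈ stdSimplex ℝ X) (N : ℕ) :
    (fun w : Fin N → X => ∏ i, P (w i)) ∈ stdSimplex ℝ (Fin N → X) :=
  ⟨fun w => Finset.prod_nonneg fun i _ => hP.1 _, by
    rw [sum_pi_prod (fun _ => P)]; simp [hP.2]⟩

/-- The matrix elements of the `N`-fold tensor power of the average state. -/
theorem sum_inner_productVector [Fintype X] (ψ : X → H) (P : X → ℝ) {N : ℕ} (v w : Fin N → H) :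
    ∑ x : Fin N → X, ((∏ i, P (x i) : ℝ) : ℂ) *
      (inner ℂ (productVector N v) (productVector N fun i => ψ (x i)) *
        inner ℂ (productVector N fun i => ψ (x i)) (productVector N w))
      = ∏ i, inner ℂ (v i) (avgState ψ P (w i)) := by
  simp only [inner_avgState]
  rw [← sum_pi_prod (fun i x => (P x : ℂ) * (inner ℂ (v i) (ψ x) * inner ℂ (ψ x) (w i)))]
  simp only [inner_productVector, Complex.ofReal_prod, Finset.prod_mul_distrib]

/-- The random coding bound on the mean error probability of codes with `m + 1` messages. -/
theorem exists_code_mean_error_le [Fintype X] [CompleteSpace H] (ψ : X → H)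
    (hψ : ∀ x, ‖ψ x‖ = 1) (N : ℕ) {P : X → ℝ} (hP : P ∈ stdSimplex ℝ X) {m : ℕ} (hm : 0 < m)
    {s : ℝ} (hs : s ∈ Set.Icc (0 : ℝ) 1) :
    ∃ (c : Fin (m + 1) → Fin N → X) (E : POVM (TPow H N) (m + 1)),
      (∑ j, (1 - superchannel ψ c E j j)) / (m + 1) ≤ 2 * (m : ℝ) ^ s * powTrace ψ s P ^ N := by
  obtain ⟨e', μ, hμ, hρ⟩ := exists_avgState_eq_diagOp ψ hψ hP
  set e := fun k => (e' k : H)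
  have he : Orthonormal ℂ e := e'.orthonormal.comp_linearIsometry (signalSpan ψ).subtypeₗᵢ
  have hmat : ∀ a b, inner ℂ (e a) (avgState ψ P (e b)) = if a = b then (μ a : ℂ) else 0 := by
    intro a b
    rw [hρ, inner_diagOp]
    simp only [orthonormal_iff_ite.1 he]
    rw [Finset.sum_eq_single a]
    · simp
    · intro k _ hk; simp [hk.symm]
    · simp
  have hpow : powTrace ψ s P ^ N
      = ∑ a : Fin N → Fin (Module.finrank ℂ (signalSpan ψ)), (∏ i, μ (a i)) ^ (1 + s) := by
    rw [powTrace_eq_sum he hμ.1 hρ hs.1]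
    simp only [← Real.finsetProd_rpow _ _ fun i _ => hμ.1 _]
    rw [sum_pi_prod (fun _ k => μ k ^ (1 + s))]
    simp
  rw [hpow]
  refine exists_code_error_le (prod_mem_stdSimplex hP N)
    (fun x => norm_productVector fun i => hψ (x i)) (orthonormal_productVector he)
    (prod_mem_stdSimplex hμ N) (fun a => ?_) (fun a b hab => ?_) hm hs
  · rw [sum_inner_productVector]
    simp [hmat]
  · rw [sum_inner_productVector]
    obtain ⟨i, hi⟩ := Function.ne_iff.1 hab
    exact Finset.prod_eq_zero (Finset.mem_univ i) (by rw [hmat, if_neg hi])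

end product

end CQ

/-! ### Regularity of the error exponent -/

namespace CQ

theorem isGreatest_le_add_of_forall_le_add {β : Type*} {F G : β → ℝ} {K : Set β} {a b C : ℝ}
    (ha : IsGreatest (F '' K) a) (hb : IsGreatest (G '' K) b) (h : ∀ x ∈ K, F x ≤ G x + C) :
    a ≤ b + C := by
  obtain ⟨x, hx, rfl⟩ := ha.1
  exact (h x hx).trans (by linarith [hb.2 ⟨x, hx, rfl⟩])

theorem isGreatest_sSup_image {β : Type*} [TopologicalSpace β] {K : Set β} (hK : IsCompact K)
    (hne : K.Nonempty) {F : β → ℝ} (hF : ContinuousOn F K) :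
    IsGreatest (F '' K) (sSup (F '' K)) :=
  (hK.image_of_continuousOn hF).isGreatest_sSup (hne.image F)

theorem rpow_one_add_sub_le {x s t : ℝ} (hx0 : 0 ≤ x) (hx1 : x ≤ 1) (hs : 0 ≤ s) (hst : s ≤ t) :
    x ^ (1 + s) - x ^ (1 + t) ≤ t - s := by
  rcases hx0.eq_or_lt with rfl | hx
  · rw [Real.zero_rpow (by linarith), Real.zero_rpow (by linarith)]; linarith
  have h1 : x ^ (1 + t) = x ^ (1 + s) * x ^ (t - s) := by
    rw [← Real.rpow_add hx]; ring_nf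
  have h2 : 1 + Real.log x * (t - s) ≤ x ^ (t - s) := by
    rw [Real.rpow_def_of_pos hx]
    linarith [Real.add_one_le_exp (Real.log x * (t - s))]
  have h3 : x ^ (1 + s) ≤ x := by
    simpa using Real.rpow_le_rpow_of_exponent_ge hx hx1 (by linarith : (1 : ℝ) ≤ 1 + s)
  have h4 : 0 ≤ x ^ (1 + s) := by positivity
  have h5 : -(x * Real.log x) ≤ 1 := by
    have := Real.add_one_le_exp (-Real.log x)
    rw [Real.exp_neg, Real.exp_log hx] at this
    have h6 := mul_le_mul_of_nonneg_left this hx.le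
    rw [mul_inv_cancel₀ hx.ne'] at h6
    nlinarith
  have hlog : 0 ≤ -Real.log x := by linarith [Real.log_nonpos hx0 hx1]
  have hts : 0 ≤ t - s := by linarith
  calc x ^ (1 + s) - x ^ (1 + t) = x ^ (1 + s) * (1 - x ^ (t - s)) := by rw [h1]; ring
    _ ≤ x ^ (1 + s) * (-Real.log x * (t - s)) := by gcongr; linarith
    _ ≤ x * (-Real.log x * (t - s)) := by gcongr
    _ = -(x * Real.log x) * (t - s) := by ring
    _ ≤ 1 * (t - s) := by gcongr
    _ = t - s := one_mul _

section exponent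

variable {X : Type*} [Fintype X] {H : Type*} [NormedAddCommGroup H] [InnerProductSpace ℂ H]
  [CompleteSpace H] {ψ : X → H}

/-- The dimension of the span of the signal states. -/
noncomputable def signalDim (ψ : X → H) : ℕ := Module.finrank ℂ (signalSpan ψ)

theorem exists_powTrace_eq_sum (hψ : ∀ x, ‖ψ x‖ = 1) {P : X → ℝ} (hP : P ∈ stdSimplex ℝ X) :
    ∃ μ ∈ stdSimplex ℝ (Fin (signalDim ψ)), ∀ s : ℝ, 0 ≤ s →
      powTrace ψ s P = ∑ k, μ k ^ (1 + s) := by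
  obtain ⟨e, μ, hμ, hρ⟩ := exists_avgState_eq_diagOp ψ hψ hP
  exact ⟨μ, hμ, fun s hs => powTrace_eq_sum
    (e.orthonormal.comp_linearIsometry (signalSpan ψ).subtypeₗᵢ) hμ.1 hρ hs⟩

theorem powTrace_zero (hψ : ∀ x, ‖ψ x‖ = 1) {P : X → ℝ} (hP : P ∈ stdSimplex ℝ X) :
    powTrace ψ 0 P = 1 := by
  obtain ⟨μ, hμ, h⟩ := exists_powTrace_eq_sum hψ hP
  simp [h 0 le_rfl, hμ.2]

theorem one_le_signalDim_mul_powTrace (hψ : ∀ x, ‖ψ x‖ = 1) {P : X → ℝ}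
    (hP : P ∈ stdSimplex ℝ X) {s : ℝ} (hs : s ∈ Set.Icc (0 : ℝ) 1) :
    1 ≤ signalDim ψ * powTrace ψ s P := by
  obtain ⟨μ, hμ, h⟩ := exists_powTrace_eq_sum hψ hP
  have h1 := sq_sum_le_card_mul_sum_sq (s := Finset.univ) (f := μ)
  rw [hμ.2, one_pow, Finset.card_univ, Fintype.card_fin] at h1
  refine h1.trans ?_
  rw [h s hs.1]
  gcongr with k
  rw [← Real.rpow_natCast]
  refine Real.rpow_le_rpow_of_exponent_ge' (hμ.1 k) (mem_Icc_of_mem_stdSimplex hμ k).2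
    (by linarith [hs.1]) ?_
  push_cast
  linarith [hs.2]

theorem powTrace_pos (hψ : ∀ x, ‖ψ x‖ = 1) {P : X → ℝ} (hP : P ∈ stdSimplex ℝ X) {s : ℝ}
    (hs : s ∈ Set.Icc (0 : ℝ) 1) : 0 < powTrace ψ s P :=
  pos_of_mul_pos_right (one_pos.trans_le (one_le_signalDim_mul_powTrace hψ hP hs))
    (Nat.cast_nonneg _)

/-- As `d/ds λ^{1+s}` is at most `1` in absolute value and the trace is at least the inverse of the
dimension, the Lipschitz constant of `-log Tr ρ^{1+s}` in `s` is at most the squared dimension. -/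
theorem negLogTrace_le_add (hψ : ∀ x, ‖ψ x‖ = 1) {P : X → ℝ} (hP : P ∈ stdSimplex ℝ X)
    {s t : ℝ} (hs : s ∈ Set.Icc (0 : ℝ) 1) (ht : t ∈ Set.Icc (0 : ℝ) 1) :
    negLogTrace ψ s P ≤ negLogTrace ψ t P + (signalDim ψ : ℝ) ^ 2 * |s - t| := by
  obtain ⟨μ, hμ, h⟩ := exists_powTrace_eq_sum hψ hP
  have hTs := powTrace_pos hψ hP hs
  have hTt := powTrace_pos hψ hP ht
  change -Real.log (powTrace ψ s P) ≤ -Real.log (powTrace ψ t P) + _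
  rcases le_total s t with hst | hst
  · have h1 : powTrace ψ t P ≤ powTrace ψ s P := by
      rw [h s hs.1, h t ht.1]
      exact Finset.sum_le_sum fun k _ => Real.rpow_le_rpow_of_exponent_ge' (hμ.1 k)
        (mem_Icc_of_mem_stdSimplex hμ k).2 (by linarith [hs.1]) (by linarith)
    have h2 := Real.log_le_log hTt h1
    have h3 : 0 ≤ (signalDim ψ : ℝ) ^ 2 * |s - t| := by positivity
    linarith
  · have hdiff : powTrace ψ t P - powTrace ψ s P ≤ signalDim ψ * (s - t) := by
      rw [h s hs.1, h t ht.1, ← Finset.sum_sub_distrib]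
      refine (Finset.sum_le_sum fun k _ => rpow_one_add_sub_le (hμ.1 k)
        (mem_Icc_of_mem_stdSimplex hμ k).2 ht.1 hst).trans ?_
      simp only [Finset.sum_const, Finset.card_univ, Fintype.card_fin, nsmul_eq_mul, le_refl]
    have h1 := Real.log_le_sub_one_of_pos (div_pos hTt hTs)
    rw [Real.log_div hTt.ne' hTs.ne'] at h1
    have h2 : powTrace ψ t P / powTrace ψ s P - 1 ≤ (signalDim ψ : ℝ) ^ 2 * (s - t) := by
      rw [div_sub_one hTs.ne', div_le_iff₀ hTs]
      have h3 := mul_le_mul_of_nonneg_left (one_le_signalDim_mul_powTrace hψ hP hs)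
        (mul_nonneg (Nat.cast_nonneg (signalDim ψ)) (sub_nonneg.2 hst))
      nlinarith
    rw [abs_of_nonneg (sub_nonneg.2 hst)]
    linarith

variable [Nonempty X]

theorem isGreatest_maxNegLogTrace (hψ : ∀ x, ‖ψ x‖ = 1) {s : ℝ} (hs : s ∈ Set.Icc (0 : ℝ) 1) :
    IsGreatest (negLogTrace ψ s '' stdSimplex ℝ X) (maxNegLogTrace ψ s) := by
  classical
  refine isGreatest_sSup_image (isCompact_stdSimplex ℝ X)
    ⟨_, single_mem_stdSimplex ℝ (Classical.arbitrary X)⟩ ?_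
  exact ((continuousOn_powTrace ψ hψ hs.1).log fun P hP => (powTrace_pos hψ hP hs).ne').neg

theorem maxNegLogTrace_le_add (hψ : ∀ x, ‖ψ x‖ = 1) {s t : ℝ} (hs : s ∈ Set.Icc (0 : ℝ) 1)
    (ht : t ∈ Set.Icc (0 : ℝ) 1) :
    maxNegLogTrace ψ s ≤ maxNegLogTrace ψ t + (signalDim ψ : ℝ) ^ 2 * |s - t| :=
  isGreatest_le_add_of_forall_le_add (isGreatest_maxNegLogTrace hψ hs)
    (isGreatest_maxNegLogTrace hψ ht) fun _ hP => negLogTrace_le_add hψ hP hs ht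

theorem maxNegLogTrace_zero (hψ : ∀ x, ‖ψ x‖ = 1) : maxNegLogTrace ψ 0 = 0 := by
  obtain ⟨P, hP, h⟩ := (isGreatest_maxNegLogTrace hψ (by simp : (0 : ℝ) ∈ Set.Icc (0 : ℝ) 1)).1
  rw [← h]
  change -Real.log (powTrace ψ 0 P) = 0
  simp [powTrace_zero hψ hP]

theorem continuousOn_maxNegLogTrace (hψ : ∀ x, ‖ψ x‖ = 1) :
    ContinuousOn (maxNegLogTrace ψ) (Set.Icc 0 1) := by
  refine (LipschitzOnWith.of_le_add_mul ((signalDim ψ : NNReal) ^ 2)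
    fun s hs t ht => ?_).continuousOn
  simpa [Real.dist_eq] using maxNegLogTrace_le_add hψ hs ht

theorem isGreatest_errorExponent (hψ : ∀ x, ‖ψ x‖ = 1) (R : ℝ) :
    IsGreatest ((fun s : ℝ => maxNegLogTrace ψ s - s * R) '' Set.Icc 0 1) (errorExponent ψ R) :=
  isGreatest_sSup_image isCompact_Icc (Set.nonempty_Icc.2 zero_le_one)
    ((continuousOn_maxNegLogTrace hψ).sub (by fun_prop))

theorem continuous_errorExponent (hψ : ∀ x, ‖ψ x‖ = 1) : Continuous (errorExponent ψ) := by
  refine (LipschitzWith.of_le_add fun R R' => ?_).continuous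
  refine isGreatest_le_add_of_forall_le_add (isGreatest_errorExponent hψ R)
    (isGreatest_errorExponent hψ R') fun s hs => ?_
  have h1 : s * (R' - R) ≤ 1 * |R - R'| := by
    rw [abs_sub_comm]
    exact (mul_le_mul_of_nonneg_left (le_abs_self _) hs.1).trans
      (mul_le_mul_of_nonneg_right hs.2 (abs_nonneg _))
  rw [Real.dist_eq]
  linarith

/-- For large rates the maximum over `s` is attained at `s = 0`. -/
theorem errorExponent_nonpos (hψ : ∀ x, ‖ψ x‖ = 1) {R : ℝ} (hR : (signalDim ψ : ℝ) ^ 2 ≤ R) :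
    errorExponent ψ R ≤ 0 := by
  obtain ⟨s, hs, h⟩ := (isGreatest_errorExponent hψ R).1
  rw [← h]
  have h1 := maxNegLogTrace_le_add hψ hs (by simp : (0 : ℝ) ∈ Set.Icc (0 : ℝ) 1)
  rw [maxNegLogTrace_zero hψ, sub_zero, abs_of_nonneg hs.1] at h1
  have h2 := mul_le_mul_of_nonneg_right hR hs.1
  simp only
  linarith

theorem exists_isGreatest_rate_bound (hψ : ∀ x, ‖ψ x‖ = 1) (N : ℕ) :
    ∃ m : ℝ, IsGreatest ((fun R : ℝ => (1 - 2 * Real.exp (-(N * errorExponent ψ R))) * R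
      - Real.log 2 / N) '' Set.Ici 0) m := by
  set F : ℝ → ℝ := fun R => (1 - 2 * Real.exp (-(N * errorExponent ψ R))) * R - Real.log 2 / N
    with hF
  have hE := continuous_errorExponent hψ
  have hFc : Continuous F := by fun_prop
  have hL : (0 : ℝ) ≤ (signalDim ψ : ℝ) ^ 2 := by positivity
  obtain ⟨R₀, hR₀, hmax⟩ := isCompact_Icc.exists_isMaxOn (Set.nonempty_Icc.2 hL) hFc.continuousOn
  refine ⟨F R₀, ⟨R₀, hR₀.1, rfl⟩, ?_⟩
  rintro _ ⟨R, hR, rfl⟩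
  have hR : 0 ≤ R := hR
  rcases le_total R ((signalDim ψ : ℝ) ^ 2) with h | h
  · exact hmax ⟨hR, h⟩
  · refine le_trans ?_ (hmax ⟨le_rfl, hL⟩ : F 0 ≤ F R₀)
    have h1 : 1 ≤ Real.exp (-(N * errorExponent ψ R)) := Real.one_le_exp <| neg_nonneg.2 <|
      mul_nonpos_of_nonneg_of_nonpos (Nat.cast_nonneg _) (errorExponent_nonpos hψ h)
    simp only [hF]
    nlinarith [mul_nonneg hR (sub_nonneg.2 h1)]

end exponent

/-! ### Achievability -/

section capacity

variable {X : Type*} {H : Type*} [NormedAddCommGroup H] [InnerProductSpace ℂ H] {ψ : X → H}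
  {N M : ℕ}

theorem superchannel_nonneg (c : Fin M → Fin N → X) (E : POVM (TPow H N) M) (j k : Fin M) :
    0 ≤ superchannel ψ c E j k :=
  (E.isPositive k).re_inner_nonneg_right _

theorem sum_superchannel (hψ : ∀ x, ‖ψ x‖ = 1) (c : Fin M → Fin N → X) (E : POVM (TPow H N) M)
    (j : Fin M) : ∑ k, superchannel ψ c E j k = 1 := by
  simp only [superchannel]
  rw [← Complex.re_sum, ← inner_sum, ← sum_apply, E.sum_effect, one_apply_eq_self,
    inner_self_eq_norm_sq_to_K, norm_productVector fun i => hψ (c j i)]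
  simp

variable [Fintype X]

theorem bddAbove_superchannelInfos (hψ : ∀ x, ‖ψ x‖ = 1) (N : ℕ) :
    BddAbove (superchannelInfos ψ N) := by
  classical
  refine ⟨Fintype.card (Fin N → X), ?_⟩
  rintro _ ⟨M, c, E, p, hp, rfl⟩
  obtain ⟨j, -, -⟩ : ∃ j ∈ Finset.univ, p j ≠ 0 :=
    Finset.exists_ne_zero_of_sum_ne_zero (hp.2 ▸ one_ne_zero)
  exact mutualInfo_le_card hp c (fun w => superchannel ψ (fun _ : Fin M => w) E j)
    (fun w k => superchannel_nonneg _ _ _ _)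
    fun w => sum_superchannel hψ _ _ _

variable [Nonempty X]

theorem blockCapacity_nonneg (hψ : ∀ x, ‖ψ x‖ = 1) (N : ℕ) : 0 ≤ blockCapacity ψ N := by
  refine le_csSup (bddAbove_superchannelInfos hψ N) ⟨1, fun _ _ => Classical.arbitrary X,
    ⟨fun _ => 1, fun _ => ContinuousLinearMap.isPositive_one, by simp⟩, fun _ => 1,
    ⟨fun _ => zero_le_one, by simp⟩, (mutualInfo_one_message _).symm⟩

variable [CompleteSpace H]

/-- The code has `⌈e^{NR}⌉` messages, so that its rate is at least `R` while the factor
`(⌈e^{NR}⌉ - 1)^s` of the random coding bound is at most `e^{sNR}`. -/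
theorem rate_bound_le_blockCapacity (hψ : ∀ x, ‖ψ x‖ = 1) (hN : 0 < N) {R : ℝ} (hR : 0 ≤ R) :
    (1 - 2 * Real.exp (-(N * errorExponent ψ R))) * R - Real.log 2 / N
      ≤ blockCapacity ψ N / N := by
  have hN' : (0 : ℝ) < N := by exact_mod_cast hN
  rw [le_div_iff₀ hN', sub_mul, div_mul_cancel₀ _ hN'.ne', mul_assoc]
  set δ := 2 * Real.exp (-(N * errorExponent ψ R)) with hδ
  have hC := blockCapacity_nonneg hψ N
  have hlog2 : 0 ≤ Real.log 2 := Real.log_nonneg one_le_two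
  rcases hR.eq_or_lt with rfl | hR
  · rw [zero_mul, mul_zero]; linarith
  have hRN : 0 < R * N := mul_pos hR hN'
  rcases le_or_gt 1 δ with hδ1 | hδ1
  · have : (1 - δ) * (R * N) ≤ 0 := mul_nonpos_of_nonpos_of_nonneg (by linarith) hRN.le
    linarith
  obtain ⟨m, hm⟩ : ∃ m, ⌈Real.exp (R * N)⌉₊ = m + 1 :=
    Nat.exists_eq_succ_of_ne_zero (Nat.ceil_pos.2 (Real.exp_pos _)).ne'
  have hm1 : Real.exp (R * N) ≤ m + 1 := by
    have := Nat.le_ceil (Real.exp (R * N))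
    rw [hm] at this
    exact_mod_cast this
  have hm2 : (m : ℝ) ≤ Real.exp (R * N) := (Nat.lt_ceil.1 (by omega)).le
  have hm0 : 0 < m := by
    have h1 : (1 : ℝ) < m + 1 := (Real.one_lt_exp_iff.2 hRN).trans_le hm1
    have : (0 : ℝ) < m := by linarith
    exact_mod_cast this
  obtain ⟨s, hs, hsE⟩ := (isGreatest_errorExponent hψ R).1
  obtain ⟨P, hP, hPs⟩ := (isGreatest_maxNegLogTrace hψ hs).1
  obtain ⟨c, E, hcE⟩ := exists_code_mean_error_le ψ hψ N hP hm0 hs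
  have hT := powTrace_pos hψ hP hs
  have herr : (∑ j, (1 - superchannel ψ c E j j)) / (m + 1) ≤ δ := by
    refine hcE.trans ?_
    have h1 : (m : ℝ) ^ s ≤ Real.exp (R * N * s) := by
      rw [Real.exp_mul]
      exact Real.rpow_le_rpow (Nat.cast_nonneg _) hm2 hs.1
    have h2 : powTrace ψ s P ^ N = Real.exp (N * Real.log (powTrace ψ s P)) := by
      rw [Real.exp_nat_mul, Real.exp_log hT]
    have h3 : errorExponent ψ R = -Real.log (powTrace ψ s P) - s * R := by
      rw [← hsE]
      exact congrArg (· - s * R) hPs.symm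
    calc 2 * (m : ℝ) ^ s * powTrace ψ s P ^ N
        ≤ 2 * Real.exp (R * N * s) * Real.exp (N * Real.log (powTrace ψ s P)) := by
          rw [h2]; gcongr
      _ = δ := by
          rw [hδ, mul_assoc, ← Real.exp_add, h3]
          ring_nf
  have hlog : R * N ≤ Real.log (m + 1) := (Real.le_log_iff_exp_le (by positivity)).2 hm1
  have hfano := fano_le_mutualInfo hm0 (superchannel ψ c E) (superchannel_nonneg c E)
    (sum_superchannel hψ c E)
  have hmem : mutualInfo (fun _ => ((m : ℝ) + 1)⁻¹) (superchannel ψ c E) ≤ blockCapacity ψ N :=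
    le_csSup (bddAbove_superchannelInfos hψ N) ⟨m + 1, c, E, _,
      ⟨fun _ => by positivity, by simp; field_simp⟩, rfl⟩
  have hprod : (1 - δ) * (R * N)
      ≤ (1 - (∑ j, (1 - superchannel ψ c E j j)) / (m + 1)) * Real.log (m + 1) :=
    mul_le_mul (by linarith) hlog hRN.le (by linarith)
  linarith

end capacity

end CQ

theorem theorem1 {X : Type*} [Fintype X] [Nonempty X]
    {H : Type*} [NormedAddCommGroup H] [InnerProductSpace ℂ H] [CompleteSpace H]
    (ψ : X → H) (hψ : ∀ x, ‖ψ x‖ = 1) (N : ℕ) (hN : 0 < N) :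
    BddAbove (CQ.superchannelInfos ψ N) ∧
    (∀ s ∈ Set.Icc (0 : ℝ) 1,
      IsGreatest (CQ.negLogTrace ψ s '' stdSimplex ℝ X) (CQ.maxNegLogTrace ψ s)) ∧
    (∀ R : ℝ, 0 ≤ R →
      IsGreatest ((fun s : ℝ => CQ.maxNegLogTrace ψ s - s * R) '' Set.Icc 0 1)
        (CQ.errorExponent ψ R)) ∧
    ∃ m : ℝ,
      IsGreatest ((fun R : ℝ => (1 - 2 * Real.exp (-(N * CQ.errorExponent ψ R))) * R
        - Real.log 2 / N) '' Set.Ici 0) m ∧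
      m ≤ CQ.blockCapacity ψ N / N := by
  refine ⟨CQ.bddAbove_superchannelInfos hψ N, fun s hs => CQ.isGreatest_maxNegLogTrace hψ hs,
    fun R _ => CQ.isGreatest_errorExponent hψ R, ?_⟩
  obtain ⟨m, hm⟩ := CQ.exists_isGreatest_rate_bound hψ N
  refine ⟨m, hm, ?_⟩
  obtain ⟨R, hR, rfl⟩ := hm.1
  exact CQ.rate_bound_le_blockCapacity hψ hN hR
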